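/- Identify functions on $\{-1,1\}^n$ with multilinear real polynomials. For a multilinear polynomial $p=\sum_{S\subseteq[n]}c_S\prod_{i\in S}x_i$ put $wt(p)=\sum_S|c_S|$. For $F:\{-1,1\}^n\to\{-1,1\}$ let $wt(F)$ be the weight of its unique multilinear expansion (its spectral norm), and let $$wt_{1/3}(F)=\inf\{wt(p)\;:\;|p(x)-F(x)|<1/3\text{ for all }x\in\{-1,1\}^n\}$$ be its $1/3$-approximate weight (approximate spectral norm). Call $F$ symmetric if it is invariant under all permutations of its $n$ variables; in that case let $D_F(i)$, $0\le i\le n$, be the value of $F$ on the inputs with exactly $i$ coordinates equal to $-1$. Let $r_0=r_0(F)$ and $r_1=r_1(F)$ be the minimal integers $r_0,r_1\ge 0$ with $r_0\le\lceil n/2\rceil$, $r_1\le\lfloor n/2\rfloor$ such that $D_F(i)=D_F(i+2)$ for all integers $i$ with $r_0\le i<n-r_1$ and $i+2\le n$ (both minima are attained simultaneously), and let $r(F)=\max\{r_0,r_1\}$. Thus $r(F)=0$ exactly when $F$ is constant or $\pm$ the parity $x_1\cdots x_n$. **Theorem.** There are universal constants $c_0,c_1>0$ such that for every $n\ge 0$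 and every symmetric function $F:\{-1,1\}^n\to\{-1,1\}$ $$c_0\cdot r(F)\log\frac{n}{r(F)}\;\ge\;\log wt(F)\;\ge\;\log wt_{1/3}(F),$$ where the left-hand side is read as $0$ if $r(F)=0$, and, whenever $r(F)\ge 1$, $$\log wt_{1/3}(F)\;\ge\;c_1\cdot r(F).$$ -/

import Mathlib

/-- The Boolean cube `{-1, 1}ⁿ`; the type `ℤˣ` has exactly the two elements `1` and `-1`. -/
abbrev Cube (n : ℕ) : Type := Fin n → ℤˣ

namespace Cube

/-- The element `1` or `-1` of `{-1, 1}` as a real number. -/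
def toReal (u : ℤˣ) : ℝ := ((u : ℤ) : ℝ)

/-- The monomial (character) `∏_{i ∈ S} x_i`. -/
def monomial {n : ℕ} (S : Finset (Fin n)) (x : Cube n) : ℝ := ∏ i ∈ S, toReal (x i)

/-- The value at `x` of the multilinear polynomial `∑_S c_S ∏_{i ∈ S} x_i`. -/
def polyEval {n : ℕ} (c : Finset (Fin n) → ℝ) (x : Cube n) : ℝ :=
  ∑ S : Finset (Fin n), c S * monomial S x

/-- The weight `∑_S |c_S|` of the multilinear polynomial with coefficients `c`. -/
def polyWeight {n : ℕ} (c : Finset (Fin n) → ℝ) : ℝ := ∑ S : Finset (Fin n), |c S|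

/-- The coefficient `2⁻ⁿ ∑_x g(x) ∏_{i ∈ S} x_i` of `g` in its multilinear expansion. -/
noncomputable def coeff {n : ℕ} (g : Cube n → ℝ) (S : Finset (Fin n)) : ℝ :=
  (1 / 2 ^ n) * ∑ x : Cube n, g x * monomial S x

theorem toReal_mul_self (u : ℤˣ) : toReal u * toReal u = 1 := by
  rcases Int.units_eq_one_or u with h | h <;> simp [toReal, h]

theorem sum_monomial_mul_point {n : ℕ} (x y : Cube n) :
    ∑ S : Finset (Fin n), monomial S x * monomial S y = if x = y then (2 : ℝ) ^ n else 0 := by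
  have h1 : ∑ S : Finset (Fin n), monomial S x * monomial S y
      = ∏ i : Fin n, (1 + toReal (x i) * toReal (y i)) := by
    rw [Finset.prod_one_add]
    simp [monomial, Finset.prod_mul_distrib]
  rw [h1]
  split_ifs with h
  · subst h
    simp only [toReal_mul_self]
    norm_num
  · obtain ⟨i, hi⟩ := Function.ne_iff.mp h
    refine Finset.prod_eq_zero (Finset.mem_univ i) ?_
    rcases Int.units_eq_one_or (x i) with hx | hx <;>
      rcases Int.units_eq_one_or (y i) with hy | hy <;> simp_all [toReal]

/-- `coeff g` is a multilinear expansion of `g`. -/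
theorem polyEval_coeff {n : ℕ} (g : Cube n → ℝ) (x : Cube n) : polyEval (coeff g) x = g x := by
  have h : polyEval (coeff g) x
      = (1 / 2 ^ n) * ∑ y : Cube n, g y * ∑ S : Finset (Fin n), monomial S y * monomial S x := by
    simp only [polyEval, coeff, Finset.mul_sum, Finset.sum_mul]
    rw [Finset.sum_comm]
    refine Finset.sum_congr rfl fun y _ => Finset.sum_congr rfl fun S _ => by ring
  rw [h]
  simp only [sum_monomial_mul_point, mul_ite, mul_zero, Finset.sum_ite_eq', Finset.mem_univ,
    if_true]
  field_simp

theorem coeff_bijective (n : ℕ) :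
    Function.Bijective (coeff : (Cube n → ℝ) → (Finset (Fin n) → ℝ)) := by
  have hinj : Function.Injective (coeff : (Cube n → ℝ) → (Finset (Fin n) → ℝ)) := by
    intro g h hgh
    funext x
    rw [← polyEval_coeff g x, hgh, polyEval_coeff]
  let L : (Cube n → ℝ) →ₗ[ℝ] (Finset (Fin n) → ℝ) :=
    { toFun := coeff
      map_add' := by
        intro g h; funext S
        simp [coeff, add_mul, Finset.sum_add_distrib, mul_add]
      map_smul' := by
        intro a g; funext S
        simp only [coeff, Pi.smul_apply, smul_eq_mul, RingHom.id_apply, Finset.mul_sum]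
        refine Finset.sum_congr rfl fun y _ => by ring }
  have hdim : Module.finrank ℝ (Cube n → ℝ) = Module.finrank ℝ (Finset (Fin n) → ℝ) := by
    simp
  exact ⟨hinj, (LinearMap.injective_iff_surjective_of_finrank_eq_finrank (f := L) hdim).1 hinj⟩

/-- `coeff g` is the only multilinear expansion of `g`. -/
theorem eq_coeff_of_polyEval_eq {n : ℕ} (g : Cube n → ℝ) (c : Finset (Fin n) → ℝ)
    (h : ∀ x, polyEval c x = g x) : c = coeff g := by
  obtain ⟨k, rfl⟩ := (coeff_bijective n).2 c
  congr 1
  funext x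
  rw [← h x, polyEval_coeff]

/-- The weight (spectral norm) of `F : {-1, 1}ⁿ → {-1, 1}`: the sum of the absolute values of the
coefficients of its unique multilinear expansion. -/
noncomputable def wt {n : ℕ} (F : Cube n → ℤˣ) : ℝ :=
  polyWeight (coeff fun x => toReal (F x))

/-- The `ε`-approximate weight (`ε`-approximate spectral norm) of `F`: the infimum of the weights
of the polynomials `p` such that `|p(x) - F(x)| < ε` for all `x` in the cube. -/
noncomputable def approxWt {n : ℕ} (ε : ℝ) (F : Cube n → ℤˣ) : ℝ :=
  sInf {w : ℝ | ∃ c : Finset (Fin n) → ℝ,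
    (∀ x : Cube n, |polyEval c x - toReal (F x)| < ε) ∧ w = polyWeight c}

/-- `F` is invariant under all permutations of its variables. -/
def IsSymm {n : ℕ} (F : Cube n → ℤˣ) : Prop :=
  ∀ (σ : Equiv.Perm (Fin n)) (x : Cube n), F (fun i => x (σ i)) = F x

/-- The number of coordinates of `x` equal to `-1`. -/
def hammingWeight {n : ℕ} (x : Cube n) : ℕ := (Finset.univ.filter fun j => x j = -1).card

/-- The input whose first `i` coordinates are `-1` and whose other coordinates are `1`. -/
def stdInput (n i : ℕ) : Cube n := fun j => if (j : ℕ) < i then -1 else 1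

/-- The predicate `D_F(i)`, the value of the symmetric function `F` on the inputs of Hamming
weight `i`. It is meaningful for `i ≤ n` only. -/
def predicate {n : ℕ} (F : Cube n → ℤˣ) (i : ℕ) : ℤˣ := F (stdInput n i)

theorem hammingWeight_stdInput {n i : ℕ} (hi : i ≤ n) : hammingWeight (stdInput n i) = i := by
  have h : (Finset.univ.filter fun j : Fin n => stdInput n i j = -1)
      = Finset.univ.filter fun j : Fin n => (j : ℕ) < i := by
    ext j
    by_cases hj : (j : ℕ) < i <;> simp [stdInput, hj]
  rw [hammingWeight, h, Fin.card_filter_val_lt, min_eq_right hi]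

theorem eq_predicate_hammingWeight {n : ℕ} {F : Cube n → ℤˣ} (hF : IsSymm F) (x : Cube n) :
    F x = predicate F (hammingWeight x) := by
  have hle : hammingWeight x ≤ n := by
    simpa [hammingWeight] using Finset.card_le_univ (Finset.univ.filter fun j => x j = -1)
  have hcard := hammingWeight_stdInput hle
  set y := stdInput n (hammingWeight x) with hy
  have hc : Fintype.card {j // y j = -1} = Fintype.card {j // x j = -1} := by
    rw [Fintype.card_subtype, Fintype.card_subtype]
    exact hcard
  let e : {j // y j = -1} ≃ {j // x j = -1} := Fintype.equivOfCardEq hc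
  have hσ : ∀ j, x (e.extendSubtype j) = y j := by
    intro j
    by_cases hj : y j = -1
    · rw [hj]; exact e.extendSubtype_mem j hj
    · have h2 := e.extendSubtype_not_mem j hj
      rw [(Int.units_eq_one_or _).resolve_right hj, (Int.units_eq_one_or _).resolve_right h2]
  rw [← hF e.extendSubtype x]
  exact congrArg F (funext hσ)

/-- The pairs `(a, b)` with `a, b ≤ n/2` such that `D_F(i) = D_F(i + 2)` for all `i ∈ [a, n - b)`
for which `D_F(i + 2)` makes sense, that is `i + 2 ≤ n`. For odd `n` the bound on `a` is rounded up
(and that on `b` down), so that such a pair always exists; `(n + 1) / 2` is the natural number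
`⌈n/2⌉`, and `n / 2` is `⌊n/2⌋`. -/
def IsAdmissible {n : ℕ} (F : Cube n → ℤˣ) (a b : ℕ) : Prop :=
  a ≤ (n + 1) / 2 ∧ b ≤ n / 2 ∧
    ∀ i : ℕ, a ≤ i → i + b < n → i + 2 ≤ n → predicate F i = predicate F (i + 2)

/-- The minimal first entry of an admissible pair. -/
noncomputable def r₀ {n : ℕ} (F : Cube n → ℤˣ) : ℕ := sInf {a | ∃ b, IsAdmissible F a b}

/-- The minimal second entry of an admissible pair. -/
noncomputable def r₁ {n : ℕ} (F : Cube n → ℤˣ) : ℕ := sInf {b | ∃ a, IsAdmissible F a b}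

/-- `r(F) = max {r₀(F), r₁(F)}`. -/
noncomputable def r {n : ℕ} (F : Cube n → ℤˣ) : ℕ := max (r₀ F) (r₁ F)

theorem isAdmissible_half {n : ℕ} (F : Cube n → ℤˣ) : IsAdmissible F ((n + 1) / 2) (n / 2) :=
  ⟨le_rfl, le_rfl, fun i h1 h2 _ => by omega⟩

/-- The two minima are attained by one and the same admissible pair. -/
theorem isAdmissible_r₀_r₁ {n : ℕ} (F : Cube n → ℤˣ) : IsAdmissible F (r₀ F) (r₁ F) := by
  obtain ⟨b, h0⟩ : r₀ F ∈ {a | ∃ b, IsAdmissible F a b} :=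
    Nat.sInf_mem ⟨_, _, isAdmissible_half F⟩
  obtain ⟨a, h1⟩ : r₁ F ∈ {b | ∃ a, IsAdmissible F a b} :=
    Nat.sInf_mem ⟨_, _, isAdmissible_half F⟩
  refine ⟨h0.1, h1.2.1, fun i hi hi' hn => ?_⟩
  have hb := h0.2.1
  have ha := h1.1
  by_cases h : 2 * i < n
  · exact h0.2.2 i hi (by omega) hn
  · exact h1.2.2 i (by omega) hi' hn

end Cube

namespace Cube

/-! Upper bound. On the layers between `r₀ F` and `n + 1 - r₁ F` the predicate has period two, so
there `F` is plus or minus a constant or the full parity, a polynomial of weight one. Every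
remaining point is repaired by a multiple of its indicator, whose weight is one. The layers at
distance at most `r` from either end contain at most `2 * exp r * (n / r) ^ r` points, which gives a
logarithm of order `r * log (n / r)`.

Lower bound. Minimality of `r₀` and `r₁` yields a jump `D_F(k) ≠ D_F(k + 2)` with about `r` layers
on each side. The approximating polynomial is averaged over random inputs built from blocks of four
coordinates: each block is constant except for one flip at a random position. A block then has
Hamming weight 1 or 3, so the total weight moves in steps of two, and a character meeting `d` blocks
in an odd number of variables is damped by at least `2 ^ (-d)` (`blockAvg_monomial`). Averaged
further over a layer, it becomes a polynomial of degree at most `d` in the layer index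
(`exists_polynomial_eval_eq_layerAvg`).

A dual functional then separates low from high degree: `exists_concentrated_dual` kills degree at
most `2 * T` while most of its mass sits on the two layers at the jump. It is bounded below on the
approximant, and each character contributes only `O(4 ^ (-T))`; hence the weight is at least `2 ^ T`
with `T` proportional to `r` (`two_pow_le_polyWeight`). Small `r` is covered by a four-point
argument (`four_thirds_le_polyWeight`). -/

/-! ### Factorial estimates -/

open Finset in
theorem prod_erase_abs_sub_eq_factorial (u s : ℕ) :
    ∏ v ∈ (range (u + 1 + s)).erase u, |(u : ℝ) - v| = (u.factorial * s.factorial : ℕ) := by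
  have h1 : ∏ v ∈ (range (u + 1 + s)).erase u, |(u : ℝ) - v|
      = ∏ v ∈ range (u + 1 + s), if v = u then 1 else |(u : ℝ) - v| := by
    rw [← mul_prod_erase (range (u + 1 + s)) _ (mem_range.2 (by omega : u < u + 1 + s)),
      if_pos rfl, one_mul]
    exact prod_congr rfl fun v hv => by rw [if_neg (ne_of_mem_erase hv)]
  rw [h1, prod_range_add, prod_range_succ, if_pos rfl, mul_one, Nat.cast_mul]
  congr 1
  · rw [← prod_range_reflect, ← prod_range_add_one_eq_factorial, Nat.cast_prod]
    refine prod_congr rfl fun v hv => ?_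
    have hv := mem_range.1 hv
    rw [if_neg (by omega), show u - 1 - v = u - (v + 1) by omega, Nat.cast_sub (by omega),
      abs_of_nonneg] <;> push_cast <;> linarith
  · rw [← prod_range_add_one_eq_factorial, Nat.cast_prod]
    refine prod_congr rfl fun v _ => ?_
    rw [if_neg (by omega), abs_of_nonpos] <;> push_cast <;> linarith

-- With `s = T - 1 - u`, the right side collapses to `s! * (u + T)!`. The two arguments add up to `2
-- * T - 1`, and a product of two factorials with fixed sum is least at the central split, which is
-- `T! * (T - 1)!`.
open Finset in
theorem factorial_mul_le_prod_erase {T u : ℕ} (hu : u < T) :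
    ((T.factorial * (T - 1).factorial : ℕ) : ℝ)
      ≤ (2 * u + 1) * ∏ v ∈ (range T).erase u, |(u : ℝ) - v| * (u + v + 1) := by
  obtain ⟨s, rfl⟩ := Nat.exists_eq_add_of_le (Nat.succ_le_of_lt hu)
  have h1 : (2 * (u : ℝ) + 1) * ∏ v ∈ (range (u.succ + s)).erase u, ((u : ℝ) + v + 1)
      = ((u + 1).ascFactorial (u.succ + s) : ℕ) := by
    rw [Nat.ascFactorial_eq_prod_range, Nat.cast_prod,
      ← mul_prod_erase (range (u.succ + s)) _ (mem_range.2 hu)]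
    congr 1
    · push_cast; ring
    · refine prod_congr rfl fun v _ => by push_cast; ring
  rw [prod_mul_distrib, mul_left_comm, h1, prod_erase_abs_sub_eq_factorial, ← Nat.cast_mul]
  norm_cast
  have h2 := Nat.factorial_mul_ascFactorial u (u.succ + s)
  rw [mul_right_comm, h2]
  set N := u.succ + s with hN
  have h3 := Nat.choose_le_middle (u + N) (2 * N - 1)
  have h4 := Nat.choose_mul_factorial_mul_factorial (n := 2 * N - 1) (k := u + N) (by omega)
  have h5 := Nat.choose_mul_factorial_mul_factorial (n := 2 * N - 1)
    (k := (2 * N - 1) / 2) (by omega)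
  rw [show 2 * N - 1 - (u + N) = s by omega] at h4
  rw [show 2 * N - 1 - (2 * N - 1) / 2 = N by omega,
    show (2 * N - 1) / 2 = N - 1 by omega] at h5
  rw [show (2 * N - 1) / 2 = N - 1 by omega] at h3
  have hpos : 0 < (2 * N - 1).choose (u + N) := Nat.choose_pos (by omega)
  refine Nat.le_of_mul_le_mul_left ?_ hpos
  calc (2 * N - 1).choose (u + N) * (N.factorial * (N - 1).factorial)
      ≤ (2 * N - 1).choose (N - 1) * (N.factorial * (N - 1).factorial) :=
        Nat.mul_le_mul_right _ h3
    _ = _ := by rw [← mul_assoc, ← mul_assoc, h4, mul_right_comm, h5]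

/-! ### The concentrated dual functional -/

/-- The offsets `0, 12, 37, 62, …` from the middle of the support of the dual functional. -/
def offset : ℕ → ℕ
  | 0 => 0
  | u + 1 => 12 + 25 * u

/-- The squared distances of the nodes from the centre. -/
noncomputable def sqNode (u : ℕ) : ℝ := ((offset u : ℝ) + 1 / 2) ^ 2

theorem sqNode_strictMono : StrictMono sqNode := by
  refine strictMono_nat_of_lt_succ fun u => ?_
  have : offset u < offset (u + 1) := by cases u <;> simp [offset]
  have : (offset u : ℝ) < offset (u + 1) := by exact_mod_cast this
  unfold sqNode
  gcongr

-- The factors are `(25 * v + 12) * (25 * v + 13)`. Shifting the grouping by one pairs `25 * w - 12`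
-- with `25 * w + 12`, whose product is at most `(25 * w) ^ 2`; only the first factor 12 and the
-- last one remain unpaired.
open Finset in
theorem prod_sqNode_sub_le (T : ℕ) :
    ∏ v ∈ range (T + 1), (sqNode (v + 1) - sqNode 0)
      ≤ 12 * 25 ^ (2 * T + 1) * ((T + 1).factorial * T.factorial : ℕ) := by
  have key : ∏ v ∈ range (T + 1), (sqNode (v + 1) - sqNode 0)
      ≤ 12 * (25 * (T + 1) - 12) * 25 ^ (2 * T) * (T.factorial : ℝ) ^ 2 := by
    induction T with
    | zero => norm_num [sqNode, offset]
    | succ T ih =>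
      rw [prod_range_succ]
      have h0 : sqNode (T + 1 + 1) - sqNode 0
          = (25 * (T + 1) + 12) * (25 * ((T + 1 : ℕ) + 1) - 12) := by
        simp only [sqNode, offset]; push_cast; ring
      have h1 : (0 : ℝ) ≤ 25 * ((T + 1 : ℕ) + 1) - 12 := by push_cast; linarith
      rw [h0]
      refine (mul_le_mul_of_nonneg_right ih (by positivity)).trans ?_
      rw [Nat.factorial_succ]
      have h2 : (25 * ((T : ℝ) + 1) - 12) * (25 * (T + 1) + 12) ≤ 25 ^ 2 * (T + 1) ^ 2 := by
        nlinarith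
      have h3 : (0 : ℝ) ≤ 12 * (25 * ((T + 1 : ℕ) + 1) - 12) * 25 ^ (2 * T)
          * (T.factorial : ℝ) ^ 2 := by positivity
      calc _ = (12 * (25 * ((T + 1 : ℕ) + 1) - 12) * 25 ^ (2 * T) * (T.factorial : ℝ) ^ 2)
            * ((25 * ((T : ℝ) + 1) - 12) * (25 * (T + 1) + 12)) := by push_cast; ring
        _ ≤ _ := mul_le_mul_of_nonneg_left h2 h3
        _ = _ := by push_cast; ring
  refine key.trans ?_
  rw [Nat.factorial_succ]
  have h3 : (0 : ℝ) ≤ 12 * 25 ^ (2 * T) * (T.factorial : ℝ) ^ 2 := by positivity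
  push_cast
  calc _ = (12 * 25 ^ (2 * T) * (T.factorial : ℝ) ^ 2) * (25 * (T + 1) - 12) := by ring
    _ ≤ (12 * 25 ^ (2 * T) * (T.factorial : ℝ) ^ 2) * (25 * (T + 1)) :=
        mul_le_mul_of_nonneg_left (by linarith) h3
    _ = _ := by ring

open Finset in
/-- The weight of the dual functional at the nodes at squared distance `sqNode u`. -/
noncomputable def nodeWeight (T u : ℕ) : ℝ :=
  (∏ v ∈ (range (T + 1)).erase u, (sqNode u - sqNode v))⁻¹ / ((offset u : ℝ) + 1 / 2)

-- The division by `offset u + 1 / 2` in the weight turns the odd power into the `l`-th power of the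
-- node `sqNode u`. The sum is then a divided difference of `X ^ l` at `T + 1` nodes, which vanishes
-- for `l < T`.
open Finset in
theorem sum_nodeWeight_mul_pow (T l : ℕ) (hl : l < T) :
    ∑ u ∈ range (T + 1), nodeWeight T u * ((offset u : ℝ) + 1 / 2) ^ (2 * l + 1) = 0 := by
  have h := Lagrange.coeff_eq_sum (s := range (T + 1)) (v := sqNode)
    sqNode_strictMono.injective.injOn (P := (Polynomial.X : Polynomial ℝ) ^ l) (by
      rw [Polynomial.degree_X_pow, card_range]; exact_mod_cast (by omega))
  rw [card_range, Polynomial.coeff_X_pow, if_neg (by omega)] at h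
  rw [h]
  refine sum_congr rfl fun u _ => ?_
  have : (offset u : ℝ) + 1 / 2 ≠ 0 := by positivity
  rw [nodeWeight, Polynomial.eval_pow, Polynomial.eval_X, pow_succ, pow_mul, ← sqNode]
  field_simp

open Finset in
theorem sum_nodeWeight_mul_odd (T : ℕ) (P : Polynomial ℝ) (hP : P.natDegree ≤ 2 * T) :
    ∑ u ∈ range (T + 1), nodeWeight T u *
      (P.eval ((offset u : ℝ) + 1 / 2) - P.eval (-((offset u : ℝ) + 1 / 2))) = 0 := by
  have h (u : ℕ) : nodeWeight T u *
      (P.eval ((offset u : ℝ) + 1 / 2) - P.eval (-((offset u : ℝ) + 1 / 2)))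
      = ∑ k ∈ range (2 * T + 1), P.coeff k * (nodeWeight T u *
        (((offset u : ℝ) + 1 / 2) ^ k - (-((offset u : ℝ) + 1 / 2)) ^ k)) := by
    rw [P.eval_eq_sum_range' (Nat.lt_succ_of_le hP), P.eval_eq_sum_range' (Nat.lt_succ_of_le hP),
      ← sum_sub_distrib, mul_sum]
    exact sum_congr rfl fun k _ => by ring
  simp only [h]
  rw [sum_comm]
  refine sum_eq_zero fun k hk => ?_
  rw [← mul_sum]
  rcases Nat.even_or_odd' k with ⟨l, rfl | rfl⟩
  · simp only [(even_two_mul l).neg_pow, sub_self, mul_zero, sum_const_zero]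
  · have hk := mem_range.1 hk
    have := sum_nodeWeight_mul_pow T l (by omega)
    have ho : Odd (2 * l + 1) := odd_two_mul_add_one l
    simp only [ho.neg_pow, sub_neg_eq_add, ← two_mul, mul_left_comm (nodeWeight T _) 2, ← mul_sum,
      this, mul_zero]

open Finset in
theorem prod_range_succ_erase_succ {T u : ℕ} (f : ℕ → ℝ) :
    ∏ v ∈ (range (T + 1)).erase (u + 1), f v = f 0 * ∏ v ∈ (range T).erase u, f (v + 1) := by
  have : (range (T + 1)).erase (u + 1)
      = insert 0 (((range T).erase u).map ⟨Nat.succ, Nat.succ_injective⟩) := by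
    ext v; cases v <;> simp
  rw [this, prod_insert (by simp), prod_map]
  rfl

-- The spacing 25 and the first offset 12 give `offset (u + 1) + 1 / 2 = 25 * (2 * u + 1) / 2`, so
-- differences of nonzero nodes factor as `25 ^ 2 * (u - v) * (u + v + 1)` and the factorial bounds
-- apply. The ratio of weights is then at most 12 divided by `sqNode (u + 1) - sqNode 0`, and this
-- gap is at least `(12 * (u + 1)) ^ 2`.
open Finset in
theorem abs_nodeWeight_succ_le {T u : ℕ} (hu : u < T) :
    |nodeWeight T (u + 1)| ≤ 1 / (12 * (u + 1) ^ 2) * |nodeWeight T 0| := by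
  obtain ⟨S, rfl⟩ : ∃ S, T = S + 1 := ⟨T - 1, by omega⟩
  set Q : ℝ := ∏ v ∈ range (S + 1), (sqNode (v + 1) - sqNode 0) with hQ
  have hQpos : 0 < Q := prod_pos fun v _ => sub_pos.2 (sqNode_strictMono (Nat.succ_pos v))
  set R : ℝ := ∏ v ∈ (range (S + 1)).erase u, |(u : ℝ) - v| * (u + v + 1) with hR
  have hfac := factorial_mul_le_prod_erase hu
  rw [Nat.add_sub_cancel, ← hR] at hfac
  have hRpos : 0 < R := by
    have : (0 : ℝ) < (2 * u + 1) * R :=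
      lt_of_lt_of_le (by exact_mod_cast Nat.mul_pos (Nat.factorial_pos _) (Nat.factorial_pos _)) hfac
    exact pos_of_mul_pos_right this (by positivity)
  have hQR : Q ≤ 12 * 25 ^ (2 * S + 1) * ((2 * u + 1) * R) :=
    (prod_sqNode_sub_le S).trans (mul_le_mul_of_nonneg_left hfac (by positivity))
  have h0 : |nodeWeight (S + 1) 0| = 2 / Q := by
    have he : (range (S + 1 + 1)).erase 0 = (range (S + 1)).map ⟨Nat.succ, Nat.succ_injective⟩ := by
      ext v; cases v <;> simp
    rw [nodeWeight, abs_div, abs_inv, abs_prod, he, prod_map]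
    have : ∏ v ∈ range (S + 1), |sqNode 0 - sqNode (Nat.succ v)| = Q :=
      prod_congr rfl fun v _ => by
        rw [abs_sub_comm, abs_of_pos (sub_pos.2 (sqNode_strictMono (Nat.succ_pos v)))]
    simp only [Function.Embedding.coeFn_mk, this, offset]
    norm_num
    field_simp
  have hprod : ∏ v ∈ (range (S + 1)).erase u, |sqNode (u + 1) - sqNode (v + 1)|
      = 25 ^ (2 * S) * R := by
    have hcard : ((range (S + 1)).erase u).card = S := by
      rw [card_erase_of_mem (mem_range.2 hu), card_range, Nat.add_sub_cancel]
    have : (25 : ℝ) ^ (2 * S) = ∏ v ∈ (range (S + 1)).erase u, 25 ^ 2 := by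
      rw [prod_const, hcard, pow_mul]
    rw [this, hR, ← prod_mul_distrib]
    refine prod_congr rfl fun v _ => ?_
    have : sqNode (u + 1) - sqNode (v + 1) = 25 ^ 2 * (((u : ℝ) - v) * (u + v + 1)) := by
      simp only [sqNode, offset]; push_cast; ring
    rw [this, abs_mul, abs_mul, abs_of_pos (by positivity : (0 : ℝ) < 25 ^ 2),
      abs_of_pos (by positivity : (0 : ℝ) < u + v + 1)]
  have h1 : |nodeWeight (S + 1) (u + 1)|
      = 1 / ((sqNode (u + 1) - sqNode 0) * (25 ^ (2 * S) * R) * (25 * (2 * u + 1) / 2)) := by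
    rw [nodeWeight, abs_div, abs_inv, abs_prod, prod_range_succ_erase_succ, hprod,
      abs_of_pos (sub_pos.2 (sqNode_strictMono (Nat.succ_pos u))), abs_of_pos (by positivity)]
    have : (offset (u + 1) : ℝ) + 1 / 2 = 25 * (2 * u + 1) / 2 := by
      simp only [offset]; push_cast; ring
    rw [this, ← one_div, div_div]
  have h2 : (12 : ℝ) ^ 2 * (u + 1) ^ 2 ≤ sqNode (u + 1) - sqNode 0 := by
    simp only [sqNode, offset]; push_cast; nlinarith
  have hη : (0 : ℝ) < sqNode (u + 1) - sqNode 0 := lt_of_lt_of_le (by positivity) h2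
  have hq : (0 : ℝ) < 25 ^ (2 * S) := by positivity
  rw [pow_succ] at hQR
  rw [h0, h1, div_mul_div_comm, one_mul]
  clear_value Q R
  generalize (25 : ℝ) ^ (2 * S) = q at *
  generalize sqNode (u + 1) - sqNode 0 = η at *
  rw [div_le_div_iff₀ (by positivity) (by positivity)]
  have h3 : (12 * ((u : ℝ) + 1) ^ 2) * Q
      ≤ (12 * ((u : ℝ) + 1) ^ 2) * (12 * (q * 25) * ((2 * u + 1) * R)) :=
    mul_le_mul_of_nonneg_left hQR (by positivity)
  have h4 := mul_le_mul_of_nonneg_right h2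
    (by positivity : (0 : ℝ) ≤ q * 25 * ((2 * u + 1) * R))
  linarith

open Finset in
theorem sum_inv_sq_le (T : ℕ) : ∑ u ∈ range T, 1 / ((u : ℝ) + 1) ^ 2 ≤ 2 - 1 / (T : ℝ) := by
  induction T with
  | zero => norm_num
  | succ T ih =>
    rw [sum_range_succ]
    rcases Nat.eq_zero_or_pos T with rfl | hT
    · norm_num
    have hT : (0 : ℝ) < T := by exact_mod_cast hT
    have : 1 / ((T : ℝ) + 1) ^ 2 ≤ 1 / T - 1 / ((T + 1 : ℕ) : ℝ) := by
      push_cast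
      rw [div_sub_div _ _ hT.ne' (by positivity), div_le_div_iff₀ (by positivity) (by positivity)]
      nlinarith
    linarith

open Finset in
/-- A functional that annihilates polynomials of degree at most `2 * T` and is concentrated on the
two points next to the centre. -/
theorem exists_concentrated_dual (T : ℕ) :
    ∃ m : ℕ → ℝ, m 0 = 1 ∧ ∑ u ∈ range T, |m (u + 1)| ≤ 1 / 6 ∧
      ∀ (z : ℝ) (P : Polynomial ℝ), P.natDegree ≤ 2 * T →
        ∑ u ∈ range (T + 1), m u * (P.eval (z + 1 + offset u) - P.eval (z - offset u)) = 0 := by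
  have h0 : nodeWeight T 0 ≠ 0 := by
    have : ∏ v ∈ (range (T + 1)).erase 0, (sqNode 0 - sqNode v) ≠ 0 :=
      prod_ne_zero_iff.2 fun v hv =>
        sub_ne_zero.2 (sqNode_strictMono.injective.ne (ne_of_mem_erase hv).symm)
    exact div_ne_zero (inv_ne_zero this) (by positivity)
  refine ⟨fun u => nodeWeight T u / nodeWeight T 0, div_self h0, ?_, fun z P hP => ?_⟩
  · calc ∑ u ∈ range T, |nodeWeight T (u + 1) / nodeWeight T 0|
        ≤ ∑ u ∈ range T, 1 / 12 * (1 / ((u : ℝ) + 1) ^ 2) := by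
          refine sum_le_sum fun u hu => ?_
          rw [abs_div, div_le_iff₀ (abs_pos.2 h0), one_div_mul_one_div]
          exact abs_nodeWeight_succ_le (mem_range.1 hu)
      _ ≤ 1 / 6 := by
          rw [← mul_sum]
          have := sum_inv_sq_le T
          have : (0 : ℝ) ≤ 1 / T := by positivity
          linarith
  -- Recentre at `z + 1 / 2`, the midpoint of the two central points `z` and `z + 1`.
  · have h := sum_nodeWeight_mul_odd T (P.comp (Polynomial.X + Polynomial.C (z + 1 / 2))) (by
      rw [Polynomial.natDegree_comp, Polynomial.natDegree_X_add_C, mul_one]; exact hP)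
    rw [← mul_right_inj' (inv_ne_zero h0), mul_zero, mul_sum] at h
    rw [← h]
    refine sum_congr rfl fun u _ => ?_
    simp only [Polynomial.eval_comp, Polynomial.eval_add, Polynomial.eval_X, Polynomial.eval_C]
    rw [show (offset u : ℝ) + 1 / 2 + (z + 1 / 2) = z + 1 + offset u by ring,
      show -((offset u : ℝ) + 1 / 2) + (z + 1 / 2) = z - offset u by ring]
    ring

/-! ### Averages of characters over a layer -/

theorem abs_toReal (u : ℤˣ) : |toReal u| = 1 := by
  rcases Int.units_eq_one_or u with h | h <;> simp [toReal, h]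

theorem toReal_mul (u v : ℤˣ) : toReal (u * v) = toReal u * toReal v := by simp [toReal]

theorem abs_monomial {n : ℕ} (S : Finset (Fin n)) (x : Cube n) : |monomial S x| = 1 := by
  rw [monomial, Finset.abs_prod]
  exact Finset.prod_eq_one fun i _ => abs_toReal _

/-- `-1` if `p` holds and `1` otherwise. -/
def sign (p : Prop) [Decidable p] : ℤˣ := if p then -1 else 1

open Finset in
/-- The average of the monomial with variable set `O` over the inputs of Hamming weight `i`, an
input being given by its set of coordinates equal to `-1`. -/
noncomputable def layerAvg {M : ℕ} (i : ℕ) (O : Finset (Fin M)) : ℝ :=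
  (1 / (M.choose i : ℝ)) * ∑ Y ∈ powersetCard i (univ : Finset (Fin M)), ∏ v ∈ O, toReal (sign (v ∈ Y))

open Finset in
theorem abs_layerAvg_le {M : ℕ} (i : ℕ) (O : Finset (Fin M)) : |layerAvg i O| ≤ 1 := by
  rw [layerAvg, abs_mul, abs_of_nonneg (by positivity)]
  calc _ ≤ 1 / (M.choose i : ℝ) * ∑ Y ∈ powersetCard i (univ : Finset (Fin M)), (1 : ℝ) := by
        gcongr
        refine (abs_sum_le_sum_abs _ _).trans (sum_le_sum fun Y _ => ?_)
        rw [abs_prod]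
        exact (prod_eq_one fun v _ => abs_toReal _).le
    _ ≤ 1 := by
        rw [sum_const, card_powersetCard, card_univ, Fintype.card_fin, nsmul_eq_mul, mul_one,
          one_div_mul_eq_div]
        exact div_self_le_one _

-- Expand each sign as `1 - 2 * [v ∈ Y]`. The probability that a random `Y` of size `i` contains `U`
-- is `i.choose U.card / M.choose U.card`, a polynomial in `i` of degree `U.card`.
open Finset in
theorem exists_polynomial_eval_eq_layerAvg {M : ℕ} (O : Finset (Fin M)) :
    ∃ P : Polynomial ℝ, P.natDegree ≤ O.card ∧
      ∀ i : ℕ, i ≤ M → layerAvg i O = P.eval (i : ℝ) := by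
  refine ⟨∑ U ∈ O.powerset, Polynomial.C ((-2) ^ U.card / (U.card.factorial * M.choose U.card : ℝ))
    * descPochhammer ℝ U.card, ?_, fun i hi => ?_⟩
  · refine Polynomial.natDegree_sum_le_of_forall_le _ _ fun U hU => ?_
    refine (Polynomial.natDegree_C_mul_le _ _).trans ?_
    rw [descPochhammer_natDegree]
    exact card_le_card (mem_powerset.1 hU)
  · have h1 (Y : Finset (Fin M)) : ∏ v ∈ O, toReal (sign (v ∈ Y))
        = ∑ U ∈ O.powerset, (-2 : ℝ) ^ U.card * if U ⊆ Y then 1 else 0 := by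
      have : ∀ v ∈ O, toReal (sign (v ∈ Y)) = 1 + if v ∈ Y then (-2 : ℝ) else 0 := fun v _ => by
        by_cases h : v ∈ Y <;> simp [sign, h, toReal]; norm_num
      rw [prod_congr rfl this, prod_one_add]
      refine sum_congr rfl fun U _ => ?_
      rw [prod_ite_zero]
      simp [prod_const, subset_iff]
    have hC : (M.choose i : ℝ) ≠ 0 := by exact_mod_cast (Nat.choose_pos hi).ne'
    rw [layerAvg, sum_congr rfl fun Y _ => h1 Y, sum_comm, mul_sum, Polynomial.eval_finsetSum]
    refine sum_congr rfl fun U _ => ?_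
    have hUM : U.card ≤ M := by simpa using card_le_univ U
    have hD : (M.choose U.card : ℝ) ≠ 0 := by exact_mod_cast (Nat.choose_pos hUM).ne'
    have hf : (U.card.factorial : ℝ) ≠ 0 := by exact_mod_cast (Nat.factorial_pos _).ne'
    have hcount : ((∑ Y ∈ powersetCard i (univ : Finset (Fin M)), if U ⊆ Y then (1 : ℝ) else 0))
        * M.choose U.card = M.choose i * i.choose U.card := by
      rw [sum_boole]
      by_cases hUi : U.card ≤ i
      · rw [card_filter_powersetCard_subset U univ i (subset_univ U) hUi]
        have := Nat.choose_mul (n := M) hUi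
        simp only [card_univ, Fintype.card_fin]
        rw [mul_comm]
        exact_mod_cast this.symm
      · rw [Nat.choose_eq_zero_of_lt (n := i) (k := U.card) (by omega), filter_false_of_mem]
        · simp
        · intro Y hY hUY
          have := card_le_card hUY
          rw [(mem_powersetCard.1 hY).2] at this
          exact hUi this
    rw [Polynomial.eval_mul, Polynomial.eval_C, descPochhammer_eval_eq_descFactorial,
      Nat.descFactorial_eq_factorial_mul_choose, ← mul_sum]
    push_cast
    field_simp
    linear_combination hcount

/-! ### Averages over block points -/

/-- The input that, on the block `e (i, ·)` of four coordinates, equals the sign of `i ∈ Y` except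
for a change of sign at `e (i, k i)`, and that agrees with `z` outside the blocks. -/
noncomputable def blockPoint {n M : ℕ} (e : Fin M × Fin 4 ↪ Fin n) (z : Cube n)
    (Y : Finset (Fin M)) (k : Fin M → Fin 4) : Cube n :=
  Function.extend e (fun q => sign (q.1 ∈ Y) * sign (q.2 = k q.1)) z

-- A block contains three coordinates `-1` if `i ∈ Y` and one otherwise, wherever its flip is; so
-- the layer depends on `Y.card` alone and moves in steps of two.
open Finset in
theorem hammingWeight_blockPoint {n M : ℕ} (e : Fin M × Fin 4 ↪ Fin n) (z : Cube n)
    (Y : Finset (Fin M)) (k : Fin M → Fin 4) :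
    hammingWeight (blockPoint e z Y k)
      = (univ.filter fun v => v ∉ Set.range e ∧ z v = -1).card + M + 2 * Y.card := by
  classical
  have hblock (i : Fin M) : (univ.filter fun j : Fin 4 => sign (i ∈ Y) * sign (j = k i) = -1).card
      = 1 + 2 * if i ∈ Y then 1 else 0 := by
    generalize k i = κ
    by_cases h : i ∈ Y <;> simp only [h, sign, if_true, if_false] <;> revert κ <;> decide
  have hin : (univ.filter fun v => v ∈ Set.range e ∧ blockPoint e z Y k v = -1).card
      = M + 2 * Y.card := by
    have : (univ.filter fun v => v ∈ Set.range e ∧ blockPoint e z Y k v = -1)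
        = (univ.filter fun q : Fin M × Fin 4 =>
            sign (q.1 ∈ Y) * sign (q.2 = k q.1) = -1).map e := by
      ext v
      simp only [mem_filter, mem_univ, true_and, mem_map, Set.mem_range]
      constructor
      · rintro ⟨⟨q, rfl⟩, h⟩
        rw [blockPoint, e.injective.extend_apply] at h
        exact ⟨q, h, rfl⟩
      · rintro ⟨q, h, rfl⟩
        rw [blockPoint, e.injective.extend_apply]
        exact ⟨⟨q, rfl⟩, h⟩
    rw [this, card_map, card_filter, Fintype.sum_prod_type]
    simp_rw [← card_filter, hblock]
    simp [sum_add_distrib, mul_comm]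
  have hout : (univ.filter fun v => v ∉ Set.range e ∧ blockPoint e z Y k v = -1)
      = univ.filter fun v => v ∉ Set.range e ∧ z v = -1 := by
    refine filter_congr fun v _ => and_congr_right fun hv => ?_
    rw [blockPoint, Function.extend_apply' _ _ _ hv]
  rw [hammingWeight, ← card_filter_add_card_filter_not (fun v => v ∈ Set.range e), filter_filter,
    filter_filter, add_assoc, ← hin, ← hout, add_comm]
  simp only [and_comm]

open Finset in
theorem monomial_blockPoint {n M : ℕ} (e : Fin M × Fin 4 ↪ Fin n) (z : Cube n) (S : Finset (Fin n)) :
    ∃ c : ℝ, |c| = 1 ∧ ∃ A : Fin M → Finset (Fin 4), ∀ Y k, monomial S (blockPoint e z Y k)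
      = c * ∏ i, ∏ j ∈ A i, (toReal (sign (i ∈ Y)) * toReal (sign (j = k i))) := by
  classical
  refine ⟨∏ v ∈ S.filter (· ∉ Set.range e), toReal (z v), ?_,
    fun i => univ.filter fun j => e (i, j) ∈ S, fun Y k => ?_⟩
  · rw [abs_prod]
    exact prod_eq_one fun i _ => abs_toReal _
  · rw [monomial, ← prod_filter_mul_prod_filter_not S (· ∈ Set.range e), mul_comm]
    congr 1
    · refine prod_congr rfl fun v hv => ?_
      rw [blockPoint, Function.extend_apply' _ _ _ (mem_filter.1 hv).2]
    · have : S.filter (· ∈ Set.range e)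
          = (univ.filter fun q : Fin M × Fin 4 => e q ∈ S).map e := by
        ext v
        simp only [mem_filter, mem_univ, true_and, mem_map, Set.mem_range]
        constructor
        · rintro ⟨h, q, rfl⟩; exact ⟨q, h, rfl⟩
        · rintro ⟨q, h, rfl⟩; exact ⟨h, q, rfl⟩
      rw [this, prod_map, prod_filter, Fintype.prod_prod_type]
      refine prod_congr rfl fun i _ => ?_
      rw [prod_filter]
      refine prod_congr rfl fun j _ => ?_
      rw [blockPoint, e.injective.extend_apply, toReal_mul]

open Finset in
theorem sum_prod_sign_eq (A : Finset (Fin 4)) :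
    ∑ κ : Fin 4, ∏ j ∈ A, toReal (sign (j = κ)) = 4 - 2 * A.card := by
  have h (κ : Fin 4) : ∏ j ∈ A, toReal (sign (j = κ)) = 1 - 2 * if κ ∈ A then 1 else 0 := by
    have (j : Fin 4) : toReal (sign (j = κ)) = if j = κ then -1 else 1 := by
      by_cases h : j = κ <;> simp [sign, toReal, h]
    simp_rw [this]
    rw [prod_ite_eq']
    split_ifs <;> norm_num
  simp_rw [h]
  rw [sum_sub_distrib, ← mul_sum]
  simp

open Finset in
/-- The average of `g` over the block points whose set `Y` has `i` elements. -/
noncomputable def blockAvg {n M : ℕ} (e : Fin M × Fin 4 ↪ Fin n) (z : Cube n) (i : ℕ)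
    (g : Cube n → ℝ) : ℝ :=
  (1 / (M.choose i : ℝ)) * ∑ Y ∈ powersetCard i (univ : Finset (Fin M)),
    (1 / 4 ^ M) * ∑ k : Fin M → Fin 4, g (blockPoint e z Y k)

-- The flips are independent, so the average factors over blocks. A block meeting `S` in `a`
-- variables contributes `(4 - 2 * a) / 4`, which is `±1 / 2` for odd `a` and at most one in
-- absolute value otherwise. Only blocks with odd `a` still depend on `Y`; they form `O`.
open Finset in
theorem blockAvg_monomial {n M : ℕ} (e : Fin M × Fin 4 ↪ Fin n) (z : Cube n) (S : Finset (Fin n)) :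
    ∃ (κ : ℝ) (O : Finset (Fin M)), |κ| ≤ (1 / 2) ^ O.card ∧
      ∀ i, blockAvg e z i (monomial S) = κ * layerAvg i O := by
  obtain ⟨c, hc, A, hA⟩ := monomial_blockPoint e z S
  refine ⟨c * ∏ i, ((4 - 2 * ((A i).card : ℝ)) / 4), univ.filter fun i => Odd (A i).card, ?_,
    fun i => ?_⟩
  · rw [abs_mul, hc, one_mul, abs_prod, ← prod_const, prod_filter]
    refine prod_le_prod (fun i _ => abs_nonneg _) fun i _ => ?_
    have h4 : (A i).card ≤ 4 := by simpa using card_le_univ (A i)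
    generalize (A i).card = a at *
    interval_cases a
    · norm_num
    · rw [if_pos (by decide), abs_le]; norm_num
    · norm_num
    · rw [if_pos (by decide), abs_le]; norm_num
    · rw [if_neg (by decide), abs_le]; norm_num
  · have hsign (Y : Finset (Fin M)) : ∏ i, toReal (sign (i ∈ Y)) ^ (A i).card
        = ∏ v ∈ univ.filter (fun i => Odd (A i).card), toReal (sign (v ∈ Y)) := by
      rw [prod_filter]
      refine prod_congr rfl fun v _ => ?_
      have hsq : toReal (sign (v ∈ Y)) ^ 2 = 1 := by rw [sq, toReal_mul_self]
      rcases Nat.even_or_odd' (A v).card with ⟨l, h | h⟩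
      · rw [if_neg (by rw [h]; simp), h, pow_mul, hsq, one_pow]
      · rw [if_pos (by rw [h]; simp), h, pow_succ, pow_mul, hsq, one_pow, one_mul]
    have h (Y : Finset (Fin M)) : (1 / 4 ^ M) * ∑ k : Fin M → Fin 4, monomial S (blockPoint e z Y k)
        = c * (∏ i, ((4 - 2 * ((A i).card : ℝ)) / 4))
          * ∏ v ∈ univ.filter (fun i => Odd (A i).card), toReal (sign (v ∈ Y)) := by
      simp_rw [hA, prod_mul_distrib, prod_const, ← mul_sum]
      have := sum_prod_piFinset (univ : Finset (Fin 4))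
        fun (i : Fin M) κ => ∏ j ∈ A i, toReal (sign (j = κ))
      rw [Fintype.piFinset_univ] at this
      rw [this, hsign]
      simp_rw [sum_prod_sign_eq]
      rw [prod_div_distrib, prod_const, card_univ, Fintype.card_fin]
      ring
    rw [blockAvg, layerAvg, sum_congr rfl fun Y _ => h Y, ← mul_sum]
    ring

open Finset in
theorem blockAvg_sum {n M : ℕ} {ι : Type*} (e : Fin M × Fin 4 ↪ Fin n) (z : Cube n) (i : ℕ)
    (s : Finset ι) (c : ι → ℝ) (g : ι → Cube n → ℝ) :
    blockAvg e z i (fun x => ∑ a ∈ s, c a * g a x) = ∑ a ∈ s, c a * blockAvg e z i (g a) := by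
  simp only [blockAvg, mul_sum]
  rw [sum_congr rfl fun Y _ => sum_comm, sum_comm]
  refine sum_congr rfl fun a _ => sum_congr rfl fun Y _ => sum_congr rfl fun k _ => by ring

open Finset in
theorem abs_blockAvg_sub_le {n M : ℕ} (e : Fin M × Fin 4 ↪ Fin n) (z : Cube n) {i : ℕ} (hi : i ≤ M)
    (g : Cube n → ℝ) (a ε : ℝ)
    (h : ∀ Y k, Y.card = i → |g (blockPoint e z Y k) - a| ≤ ε) :
    |blockAvg e z i g - a| ≤ ε := by
  have hC : (M.choose i : ℝ) ≠ 0 := by exact_mod_cast (Nat.choose_pos hi).ne'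
  have h1 : blockAvg e z i g - a = blockAvg e z i (fun x => g x - a) := by
    simp only [blockAvg, sum_sub_distrib, mul_sub, sum_const, card_univ, card_powersetCard,
      Fintype.card_fin, Fintype.card_fun, nsmul_eq_mul]
    congr 1
    push_cast
    field_simp
  rw [h1, blockAvg, abs_mul, abs_of_nonneg (by positivity)]
  calc _ ≤ 1 / (M.choose i : ℝ) * ∑ Y ∈ powersetCard i (univ : Finset (Fin M)), ε := by
        gcongr
        refine (abs_sum_le_sum_abs _ _).trans (sum_le_sum fun Y hY => ?_)
        rw [abs_mul, abs_of_nonneg (by positivity)]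
        calc _ ≤ (1 : ℝ) / 4 ^ M * ∑ k : Fin M → Fin 4, ε := by
              gcongr
              exact (abs_sum_le_sum_abs _ _).trans
                (sum_le_sum fun k _ => h Y k (mem_powersetCard.1 hY).2)
          _ = ε := by simp
    _ = ε := by
        rw [sum_const, card_powersetCard, card_univ, Fintype.card_fin, nsmul_eq_mul]
        field_simp

/-! ### Lower bound for the weight of an approximation -/

theorem toReal_eq_neg_of_ne {u v : ℤˣ} (h : u ≠ v) : toReal v = -toReal u := by
  rcases Int.units_eq_one_or u with hu | hu <;> rcases Int.units_eq_one_or v with hv | hv <;>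
    simp_all [toReal]

theorem toReal_eq_one_or (u : ℤˣ) : toReal u = 1 ∨ toReal u = -1 := by
  rcases Int.units_eq_one_or u with h | h <;> simp [toReal, h]

theorem monomial_mul {n : ℕ} (S : Finset (Fin n)) (x y : Cube n) :
    monomial S (x * y) = monomial S x * monomial S y := by
  simp [monomial, toReal_mul, Finset.prod_mul_distrib]

theorem monomial_eq_one_or {n : ℕ} (S : Finset (Fin n)) (x : Cube n) :
    monomial S x = 1 ∨ monomial S x = -1 :=
  eq_or_eq_neg_of_abs_eq (abs_monomial S x)

open Finset in
/-- Four points spanning a two-dimensional face on which `F` is not constant-or-parity-like force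
the weight of an approximating polynomial to be at least `4 / 3`. -/
theorem four_thirds_le_polyWeight {n : ℕ} {F : Cube n → ℤˣ} (hF : IsSymm F)
    {c : Finset (Fin n) → ℝ} (hc : ∀ x, |polyEval c x - toReal (F x)| < 1 / 3)
    {k : ℕ} (hk : k + 2 ≤ n) (hD : predicate F k ≠ predicate F (k + 2)) :
    4 / 3 ≤ polyWeight c := by
  set σ : Equiv.Perm (Fin n) := Equiv.swap ⟨k, by omega⟩ ⟨k + 1, by omega⟩
  set v : Cube n := fun j => stdInput n (k + 1) (σ j) with hv
  have hFv : F v = predicate F (k + 1) := hF σ _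
  have hprod : stdInput n k * stdInput n (k + 2) = v * stdInput n (k + 1) := by
    funext j
    simp only [Pi.mul_apply, hv, σ, Equiv.swap_apply_def, stdInput, Fin.ext_iff]
    rcases lt_trichotomy (j : ℕ) k with h | h | h
    · simp [h, h.ne, show ¬ (j : ℕ) = k + 1 by omega, show (j : ℕ) < k + 2 by omega,
        show (j : ℕ) < k + 1 by omega]
    · simp [h]
    · by_cases h' : (j : ℕ) = k + 1
      · simp [h']
      · simp [h', h.ne', show ¬ (j : ℕ) < k by omega, show ¬ (j : ℕ) < k + 2 by omega,
          show ¬ (j : ℕ) < k + 1 by omega]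
  set a := toReal (predicate F k) with ha
  set b := toReal (predicate F (k + 1)) with hb
  have ha' : toReal (predicate F (k + 2)) = -a := toReal_eq_neg_of_ne hD
  -- By `hprod`, a character either agrees on both opposite pairs of the face, and the two `a` terms
  -- cancel, or differs on both, and the two `b` terms cancel. At most 2 survives, whereas the
  -- approximation makes the left side at least `4 * (2 / 3)`.
  have hsum : a * polyEval c (stdInput n k) + b * polyEval c v + b * polyEval c (stdInput n (k + 1))
      - a * polyEval c (stdInput n (k + 2)) ≤ 2 * polyWeight c := by
    simp only [polyEval, polyWeight, mul_sum, ← sum_add_distrib, ← sum_sub_distrib]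
    refine sum_le_sum fun S _ => ?_
    have hS := congrArg (monomial S) hprod
    rw [monomial_mul, monomial_mul] at hS
    have h1 := neg_abs_le (c S)
    have h2 := le_abs_self (c S)
    rcases toReal_eq_one_or (predicate F k) with h | h <;>
      rcases toReal_eq_one_or (predicate F (k + 1)) with h' | h' <;>
      rcases monomial_eq_one_or S (stdInput n k) with h3 | h3 <;>
      rcases monomial_eq_one_or S v with h4 | h4 <;>
      rcases monomial_eq_one_or S (stdInput n (k + 1)) with h5 | h5 <;>
      rw [h3, h4, h5] at hS <;> rw [ha, hb, h, h', h3, h4, h5] <;> nlinarith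
  have e1 : |polyEval c (stdInput n k) - a| < 1 / 3 := hc _
  have e2 : |polyEval c v - b| < 1 / 3 := by rw [hb, ← hFv]; exact hc v
  have e3 : |polyEval c (stdInput n (k + 1)) - b| < 1 / 3 := hc _
  have e4 : |polyEval c (stdInput n (k + 2)) - -a| < 1 / 3 := by rw [← ha']; exact hc _
  rw [abs_lt] at e1 e2 e3 e4
  rcases toReal_eq_one_or (predicate F k) with h | h <;>
    rcases toReal_eq_one_or (predicate F (k + 1)) with h' | h' <;>
    rw [← ha] at h <;> rw [← hb] at h' <;> rw [h, h'] at hsum <;> rw [h] at e1 e4 <;>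
    rw [h'] at e2 e3 <;> linarith [e1.1, e1.2, e2.1, e2.2, e3.1, e3.2, e4.1, e4.2]

/-- The embedding of `M` blocks of four coordinates as the first coordinates. -/
def blockEmb {n M : ℕ} (h : M * 4 ≤ n) : Fin M × Fin 4 ↪ Fin n :=
  finProdFinEquiv.toEmbedding.trans (Fin.castLEEmb h)

theorem mem_range_blockEmb {n M : ℕ} (h : M * 4 ≤ n) (v : Fin n) :
    v ∈ Set.range (blockEmb h) ↔ (v : ℕ) < M * 4 := by
  constructor
  · rintro ⟨q, rfl⟩
    exact (finProdFinEquiv q).2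
  · intro hv
    exact ⟨finProdFinEquiv.symm ⟨v, hv⟩, by
      simp only [blockEmb, Function.Embedding.trans_apply, Equiv.coe_toEmbedding,
        Equiv.apply_symm_apply]
      rfl⟩

open Finset in
theorem card_stdInput_outside_blocks {n M s : ℕ} (h : M * 4 + s ≤ n) :
    (univ.filter fun v => v ∉ Set.range (blockEmb (n := n) (M := M) (by omega)) ∧
      stdInput n (M * 4 + s) v = -1).card = s := by
  have h1 : (univ.filter fun v => v ∉ Set.range (blockEmb (n := n) (M := M) (by omega)) ∧
      stdInput n (M * 4 + s) v = -1)
      = (univ.filter fun v : Fin n => (v : ℕ) < M * 4 + s) \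
        univ.filter fun v : Fin n => (v : ℕ) < M * 4 := by
    ext v
    simp only [mem_filter, mem_univ, true_and, mem_sdiff, mem_range_blockEmb, stdInput]
    by_cases hv : (v : ℕ) < M * 4 + s <;> simp [hv]
  rw [h1, card_sdiff_of_subset, Fin.card_filter_val_lt, Fin.card_filter_val_lt]
  · omega
  · intro v hv
    simp only [mem_filter, mem_univ, true_and] at hv ⊢
    omega

theorem offset_mono : Monotone offset := by
  refine monotone_nat_of_le_succ fun u => ?_
  cases u <;> simp [offset]

open Finset in
theorem two_pow_le_polyWeight {n : ℕ} {F : Cube n → ℤˣ} (hF : IsSymm F)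
    {c : Finset (Fin n) → ℝ} (hc : ∀ x, |polyEval c x - toReal (F x)| < 1 / 3)
    {k T : ℕ} (hT : 1 ≤ T) (hk : 4 * offset T + 1 ≤ k) (hkn : k + 4 * offset T + 3 ≤ n)
    (hD : predicate F k ≠ predicate F (k + 2)) :
    (2 : ℝ) ^ T ≤ polyWeight c := by
  set B := offset T with hB
  obtain ⟨s, rfl⟩ := Nat.exists_eq_add_of_le hk
  -- The layer indices `0, …, 2 * B + 1` are symmetric about `B + 1 / 2` and hold the whole support
  -- of the functional; the `s` fixed coordinates `-1` put the jump between indices `B` and `B + 1`.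
  set M := 2 * B + 1 with hM
  have hMn : M * 4 + s ≤ n := by omega
  set e : Fin M × Fin 4 ↪ Fin n := blockEmb (by omega)
  set z := stdInput n (M * 4 + s)
  obtain ⟨m, hm0, hm, hdual⟩ := exists_concentrated_dual T
  have hoff {u : ℕ} (hu : u ∈ range (T + 1)) : offset u ≤ B :=
    offset_mono (Nat.lt_succ_iff.1 (mem_range.1 hu))
  set q : ℕ → ℝ := fun i => blockAvg e z i (polyEval c) with hq
  have hqD (i : ℕ) (hi : i ≤ M) : |q i - toReal (predicate F (s + M + 2 * i))| ≤ 1 / 3 := by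
    refine abs_blockAvg_sub_le e z hi _ _ _ fun Y k hY => ?_
    have := hc (blockPoint e z Y k)
    rw [eq_predicate_hammingWeight hF, hammingWeight_blockPoint,
      card_stdInput_outside_blocks hMn, hY] at this
    exact this.le
  have hq43 (i : ℕ) (hi : i ≤ M) : |q i| ≤ 4 / 3 := by
    have h1 := hqD i hi
    have h2 := abs_toReal (predicate F (s + M + 2 * i))
    have h3 := abs_sub_abs_le_abs_sub (q i) (toReal (predicate F (s + M + 2 * i)))
    linarith
  have hjump : 4 / 3 ≤ |q (B + 1) - q B| := by
    have h1 := hqD (B + 1) (by omega)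
    have h2 := hqD B (by omega)
    rw [show s + M + 2 * (B + 1) = 4 * B + 1 + s + 2 by omega, toReal_eq_neg_of_ne hD] at h1
    rw [show s + M + 2 * B = 4 * B + 1 + s by omega] at h2
    rw [abs_le] at h1 h2
    rw [le_abs]
    rcases toReal_eq_one_or (predicate F (4 * B + 1 + s)) with h | h <;> rw [h] at h1 h2
    · right; linarith
    · left; linarith
  -- The central pair gives at least `4 / 3`, all others together at most `1 / 6 * (8 / 3) = 4 / 9`.
  have hlow : 8 / 9 ≤ |∑ u ∈ range (T + 1), m u * (q (B + 1 + offset u) - q (B - offset u))| := by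
    rw [sum_range_succ', hm0, one_mul]
    have hrest : |∑ u ∈ range T, m (u + 1) * (q (B + 1 + offset (u + 1)) - q (B - offset (u + 1)))|
        ≤ 1 / 6 * (8 / 3) := by
      refine (abs_sum_le_sum_abs _ _).trans ?_
      calc _ ≤ ∑ u ∈ range T, |m (u + 1)| * (8 / 3) := by
            refine sum_le_sum fun u hu => ?_
            have hu' : offset (u + 1) ≤ B := hoff (by simpa using hu)
            rw [abs_mul]
            refine mul_le_mul_of_nonneg_left ?_ (abs_nonneg _)
            have := abs_sub (q (B + 1 + offset (u + 1))) (q (B - offset (u + 1)))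
            have := hq43 (B + 1 + offset (u + 1)) (by omega)
            have := hq43 (B - offset (u + 1)) (by omega)
            linarith
        _ ≤ _ := by
            rw [← sum_mul]
            linarith
    have h3 := abs_add_le (∑ u ∈ range T, m (u + 1) *
      (q (B + 1 + offset (u + 1)) - q (B - offset (u + 1))) + (q (B + 1) - q B))
      (-∑ u ∈ range T, m (u + 1) * (q (B + 1 + offset (u + 1)) - q (B - offset (u + 1))))
    rw [abs_neg, add_neg_cancel_comm] at h3
    change 8 / 9 ≤ |_ + (q (B + 1) - q B)|
    linarith
  -- Degree at most `2 * T` is annihilated and higher degree is damped. The factor `7 / 3` is twice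
  -- the bound `1 + 1 / 6` on the mass of `m`.
  have hmon (S : Finset (Fin n)) : |∑ u ∈ range (T + 1), m u *
      (blockAvg e z (B + 1 + offset u) (monomial S) - blockAvg e z (B - offset u) (monomial S))|
      ≤ 7 / 3 * (1 / 2) ^ (2 * T + 1) := by
    obtain ⟨κ, O, hκ, hO⟩ := blockAvg_monomial e z S
    simp_rw [hO]
    by_cases hcard : O.card ≤ 2 * T
    · obtain ⟨P, hP, hPe⟩ := exists_polynomial_eval_eq_layerAvg O
      have h0 := hdual B P (hP.trans hcard)
      have : ∑ u ∈ range (T + 1), m u *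
          (κ * layerAvg (B + 1 + offset u) O - κ * layerAvg (B - offset u) O) = 0 := by
        rw [← mul_zero κ, ← h0, mul_sum]
        refine sum_congr rfl fun u hu => ?_
        have hu' := hoff hu
        rw [hPe _ (by omega), hPe _ (by omega), Nat.cast_sub hu']
        push_cast
        ring
      rw [this, abs_zero]
      positivity
    · have hκ' : |κ| ≤ (1 / 2) ^ (2 * T + 1) :=
        hκ.trans (pow_le_pow_of_le_one (by norm_num) (by norm_num) (by omega))
      refine (abs_sum_le_sum_abs _ _).trans ?_
      calc _ ≤ ∑ u ∈ range (T + 1), |m u| * (2 * (1 / 2) ^ (2 * T + 1)) := by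
            refine sum_le_sum fun u _ => ?_
            rw [abs_mul, ← mul_sub, abs_mul]
            refine mul_le_mul_of_nonneg_left ?_ (abs_nonneg _)
            rw [mul_comm 2]
            refine mul_le_mul hκ' ?_ (abs_nonneg _) (by positivity)
            have := abs_sub (layerAvg (B + 1 + offset u) O) (layerAvg (B - offset u) O)
            linarith [abs_layerAvg_le (B + 1 + offset u) O, abs_layerAvg_le (B - offset u) O]
        _ ≤ _ := by
            rw [← sum_mul, sum_range_succ', hm0, abs_one]
            have : (0 : ℝ) < (1 / 2) ^ (2 * T + 1) := by positivity
            nlinarith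
  have hup : |∑ u ∈ range (T + 1), m u * (q (B + 1 + offset u) - q (B - offset u))|
      ≤ polyWeight c * (7 / 3 * (1 / 2) ^ (2 * T + 1)) := by
    have hqs (i : ℕ) : q i = ∑ S, c S * blockAvg e z i (monomial S) :=
      blockAvg_sum e z i univ c monomial
    have : ∑ u ∈ range (T + 1), m u * (q (B + 1 + offset u) - q (B - offset u))
        = ∑ S, c S * ∑ u ∈ range (T + 1), m u * (blockAvg e z (B + 1 + offset u) (monomial S)
          - blockAvg e z (B - offset u) (monomial S)) := by
      simp_rw [hqs, ← sum_sub_distrib, mul_sum]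
      rw [sum_comm]
      refine sum_congr rfl fun S _ => sum_congr rfl fun u _ => by ring
    rw [this, polyWeight, sum_mul]
    refine (abs_sum_le_sum_abs _ _).trans (sum_le_sum fun S _ => ?_)
    rw [abs_mul]
    exact mul_le_mul_of_nonneg_left (hmon S) (abs_nonneg _)
  have h2T : (2 : ℝ) ≤ 2 ^ T := by
    calc (2 : ℝ) = 2 ^ 1 := by norm_num
      _ ≤ 2 ^ T := pow_le_pow_right₀ (by norm_num) hT
  have hfin := hlow.trans hup
  have hpow : (1 / 2 : ℝ) ^ (2 * T + 1) * (2 * 2 ^ T * 2 ^ T) = 1 := by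
    rw [one_div, inv_pow, pow_succ, pow_mul']
    field_simp
  have hW : 2 * (2 : ℝ) ^ T * 2 ^ T * (8 / 9) ≤ polyWeight c * (7 / 3) := by
    have := mul_le_mul_of_nonneg_left hfin (by positivity : (0 : ℝ) ≤ 2 * 2 ^ T * 2 ^ T)
    calc _ ≤ _ := this
      _ = polyWeight c * (7 / 3) * ((1 / 2 : ℝ) ^ (2 * T + 1) * (2 * 2 ^ T * 2 ^ T)) := by ring
      _ = _ := by rw [hpow, mul_one]
  nlinarith

/-- Lowering the larger of `r₀` and `r₁` by one destroys admissibility, and the only new index is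
`r₀ F - 1` or `n - r₁ F`; the jump is there. The rounding in the bounds on `r₀` and `r₁` keeps it
far from both ends. -/
theorem exists_jump {n : ℕ} (F : Cube n → ℤˣ) (hr : r F ≠ 0) :
    ∃ k, k + 2 ≤ n ∧ r F ≤ k + 2 ∧ r F + k ≤ n ∧ predicate F k ≠ predicate F (k + 2) := by
  have hadm := isAdmissible_r₀_r₁ F
  obtain ⟨h0, h1, h⟩ := hadm
  rcases le_total (r₁ F) (r₀ F) with hle | hle
  · have hrF : r F = r₀ F := max_eq_left hle
    have hnot : ¬ IsAdmissible F (r₀ F - 1) (r₁ F) := fun hcon =>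
      Nat.notMem_of_lt_sInf (show r₀ F - 1 < sInf {a | ∃ b, IsAdmissible F a b} by
        change _ < r₀ F; omega) ⟨_, hcon⟩
    simp only [IsAdmissible, not_and, not_forall] at hnot
    obtain ⟨i, hi1, hi2, hi3, hi4⟩ := hnot (by omega) h1
    have : i < r₀ F := by
      by_contra hcon
      exact hi4 (h i (by omega) hi2 hi3)
    exact ⟨i, hi3, by omega, by omega, hi4⟩
  · have hrF : r F = r₁ F := max_eq_right hle
    have hnot : ¬ IsAdmissible F (r₀ F) (r₁ F - 1) := fun hcon =>
      Nat.notMem_of_lt_sInf (show r₁ F - 1 < sInf {b | ∃ a, IsAdmissible F a b} by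
        change _ < r₁ F; omega) ⟨_, hcon⟩
    simp only [IsAdmissible, not_and, not_forall] at hnot
    obtain ⟨i, hi1, hi2, hi3, hi4⟩ := hnot h0 (by omega)
    have : n ≤ i + r₁ F := by
      by_contra hcon
      exact hi4 (h i hi1 (by omega) hi3)
    exact ⟨i, hi3, by omega, by omega, hi4⟩

theorem abs_polyEval_le {n : ℕ} (c : Finset (Fin n) → ℝ) (x : Cube n) :
    |polyEval c x| ≤ polyWeight c := by
  refine (Finset.abs_sum_le_sum_abs _ _).trans_eq (Finset.sum_congr rfl fun S _ => ?_)
  rw [abs_mul, abs_monomial, mul_one]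

theorem le_approxWt {n : ℕ} {F : Cube n → ℤˣ} {ε w : ℝ} (hε : 0 < ε)
    (h : ∀ c : Finset (Fin n) → ℝ, (∀ x, |polyEval c x - toReal (F x)| < ε) → w ≤ polyWeight c) :
    w ≤ approxWt ε F := by
  refine le_csInf ⟨_, coeff fun x => toReal (F x), fun x => ?_, rfl⟩ ?_
  · rw [polyEval_coeff, sub_self, abs_zero]; exact hε
  · rintro _ ⟨c, hc, rfl⟩
    exact h c hc

theorem polyWeight_nonneg {n : ℕ} (c : Finset (Fin n) → ℝ) : 0 ≤ polyWeight c :=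
  Finset.sum_nonneg fun _ _ => abs_nonneg _

theorem approxWt_le_wt {n : ℕ} {F : Cube n → ℤˣ} {ε : ℝ} (hε : 0 < ε) : approxWt ε F ≤ wt F := by
  refine csInf_le ⟨0, ?_⟩ ⟨coeff fun x => toReal (F x), fun x => ?_, rfl⟩
  · rintro _ ⟨c, -, rfl⟩
    exact polyWeight_nonneg c
  · rw [polyEval_coeff, sub_self, abs_zero]; exact hε

theorem approxWt_pos {n : ℕ} (F : Cube n → ℤˣ) : 0 < approxWt (1 / 3) F := by
  refine lt_of_lt_of_le (by norm_num : (0 : ℝ) < 2 / 3) (le_approxWt (by norm_num) fun c hc => ?_)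
  have h1 := hc 1
  have h2 := abs_polyEval_le c 1
  have h3 := abs_sub_abs_le_abs_sub (toReal (F 1)) (polyEval c 1)
  rw [abs_toReal, abs_sub_comm] at h3
  linarith

/-! ### Upper bound for the exact weight -/

open Finset in
theorem sum_pow_hammingWeight (n : ℕ) (s t : ℝ) :
    ∑ x : Cube n, s ^ hammingWeight x * t ^ (n - hammingWeight x) = (s + t) ^ n := by
  have h (x : Cube n) : ∏ i, (if x i = -1 then s else t)
      = s ^ hammingWeight x * t ^ (n - hammingWeight x) := by
    rw [prod_ite, prod_const, prod_const, hammingWeight]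
    congr 2
    have := card_filter_add_card_filter_not (s := (univ : Finset (Fin n))) fun i => x i = -1
    rw [card_univ, Fintype.card_fin] at this
    omega
  simp_rw [← h]
  have := sum_prod_piFinset (univ : Finset ℤˣ) fun (_ : Fin n) u => if u = -1 then s else t
  rw [Fintype.piFinset_univ] at this
  rw [this]
  simp [add_comm]

theorem hammingWeight_le {n : ℕ} (x : Cube n) : hammingWeight x ≤ n := by
  simpa [hammingWeight] using Finset.card_le_univ (Finset.univ.filter fun j => x j = -1)

-- Markov's inequality for the generating function: with `t = r / n`, the sum of `t ^ hammingWeight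
-- x` is `(1 + t) ^ n ≤ exp r`, and each point of the lower layers contributes at least `t ^ r`; the
-- upper layers are symmetric.
open Finset in
theorem card_extreme_layers_le {n r : ℕ} (hr : 0 < r) (hrn : r ≤ n) :
    ((univ.filter fun x : Cube n => hammingWeight x ≤ r ∨ n - hammingWeight x ≤ r).card : ℝ)
      ≤ 2 * (Real.exp r * ((n : ℝ) / r) ^ r) := by
  have hr' : (0 : ℝ) < r := by exact_mod_cast hr
  have hn' : (0 : ℝ) < n := by exact_mod_cast hr.trans_le hrn
  set t : ℝ := r / n with ht
  have ht0 : 0 < t := by positivity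
  have ht1 : t ≤ 1 := (div_le_one hn').2 (by exact_mod_cast hrn)
  have hexp : (1 + t) ^ n ≤ Real.exp r := by
    calc (1 + t) ^ n ≤ Real.exp t ^ n := by
          gcongr
          linarith [Real.add_one_le_exp t]
      _ = Real.exp r := by
          rw [← Real.exp_nat_mul, ht]
          congr 1
          field_simp
  have hsum : ∑ x : Cube n, (t ^ hammingWeight x + t ^ (n - hammingWeight x)) = 2 * (1 + t) ^ n := by
    have h1 := sum_pow_hammingWeight n t 1
    have h2 := sum_pow_hammingWeight n 1 t
    simp only [one_pow, mul_one, one_mul] at h1 h2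
    rw [sum_add_distrib, h1, h2]
    ring
  have hcard : ((univ.filter fun x : Cube n =>
      hammingWeight x ≤ r ∨ n - hammingWeight x ≤ r).card : ℝ) * t ^ r ≤ 2 * (1 + t) ^ n := by
    rw [← hsum, ← nsmul_eq_mul, ← sum_const]
    refine (sum_le_sum fun x hx => ?_).trans (sum_le_sum_of_subset_of_nonneg (filter_subset _ _)
      fun x _ _ => by positivity)
    have h1 : 0 ≤ t ^ hammingWeight x := by positivity
    have h2 : 0 ≤ t ^ (n - hammingWeight x) := by positivity
    rcases (mem_filter.1 hx).2 with h | h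
    · linarith [pow_le_pow_of_le_one ht0.le ht1 h]
    · linarith [pow_le_pow_of_le_one ht0.le ht1 h]
  have hinv : t ^ r * ((n : ℝ) / r) ^ r = 1 := by
    rw [← mul_pow, ht, div_mul_div_cancel₀ hn'.ne', div_self hr'.ne', one_pow]
  calc _ = ((univ.filter fun x : Cube n =>
      hammingWeight x ≤ r ∨ n - hammingWeight x ≤ r).card : ℝ) * t ^ r * ((n : ℝ) / r) ^ r := by
        rw [mul_assoc, hinv, mul_one]
    _ ≤ 2 * Real.exp r * ((n : ℝ) / r) ^ r := by
        exact mul_le_mul_of_nonneg_right (hcard.trans (by linarith)) (by positivity)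
    _ = _ := by ring

theorem monomial_univ {n : ℕ} (x : Cube n) :
    monomial Finset.univ x = (-1) ^ hammingWeight x := by
  have (i : Fin n) : toReal (x i) = if x i = -1 then -1 else 1 := by
    rcases Int.units_eq_one_or (x i) with h | h <;> simp [toReal, h]
  simp_rw [monomial, this, Finset.prod_ite, Finset.prod_const, one_pow, mul_one, hammingWeight]

/-- The periodicity reaches layer `n + 1 - r₁ F`, since the last index `i = n - r₁ F - 1` controls
`i + 2`. -/
theorem predicate_add_eq {n : ℕ} (F : Cube n → ℤˣ) (j : ℕ) (h1 : r₀ F + j + r₁ F ≤ n + 1)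
    (h2 : r₀ F + j ≤ n) :
    predicate F (r₀ F + j) = predicate F (r₀ F + j % 2) := by
  induction j using Nat.strong_induction_on with
  | _ j ih =>
    rcases Nat.lt_or_ge j 2 with hj | hj
    · rw [Nat.mod_eq_of_lt hj]
    · obtain ⟨i, rfl⟩ := Nat.exists_eq_add_of_le' hj
      rw [Nat.add_mod_right, ← ih i (by omega) (by omega) (by omega), ← add_assoc]
      exact ((isAdmissible_r₀_r₁ F).2.2 (r₀ F + i) (by omega) (by omega) (by omega)).symm

/-- On the middle layers a symmetric function agrees with a constant or with the parity up to
sign. -/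
theorem exists_monomial_eq_middle {n : ℕ} {F : Cube n → ℤˣ} (hF : IsSymm F) :
    ∃ c : Finset (Fin n) → ℝ, polyWeight c = 1 ∧ ∀ x, r₀ F ≤ hammingWeight x →
      hammingWeight x + r₁ F ≤ n + 1 → polyEval c x = toReal (F x) := by
  have key : ∃ (U : Finset (Fin n)) (v : ℝ), |v| = 1 ∧ ∀ x, r₀ F ≤ hammingWeight x →
      hammingWeight x + r₁ F ≤ n + 1 → v * monomial U x = toReal (F x) := by
    have hpred (x : Cube n) (hx : r₀ F ≤ hammingWeight x) (hx' : hammingWeight x + r₁ F ≤ n + 1) :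
        F x = predicate F (r₀ F + (hammingWeight x - r₀ F) % 2) := by
      have := hammingWeight_le x
      rw [eq_predicate_hammingWeight hF,
        ← predicate_add_eq F (hammingWeight x - r₀ F) (by omega) (by omega),
        Nat.add_sub_cancel' hx]
    by_cases h : predicate F (r₀ F) = predicate F (r₀ F + 1)
    · refine ⟨∅, toReal (predicate F (r₀ F)), abs_toReal _, fun x hx hx' => ?_⟩
      rw [hpred x hx hx', monomial, Finset.prod_empty, mul_one]
      rcases Nat.mod_two_eq_zero_or_one (hammingWeight x - r₀ F) with h' | h' <;> rw [h']
      · rfl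
      · rw [h]
    · refine ⟨Finset.univ, toReal (predicate F (r₀ F)) * (-1) ^ r₀ F, ?_, fun x hx hx' => ?_⟩
      · rw [abs_mul, abs_toReal, abs_pow, abs_neg, abs_one, one_pow, mul_one]
      rw [hpred x hx hx', monomial_univ]
      obtain ⟨j, hj⟩ := Nat.exists_eq_add_of_le hx
      rw [hj, Nat.add_sub_cancel_left, mul_assoc, pow_add, ← mul_assoc ((-1 : ℝ) ^ r₀ F), ← mul_pow,
        neg_one_mul, neg_neg, one_pow, one_mul]
      rcases Nat.even_or_odd j with h' | h'
      · rw [h'.neg_one_pow, Nat.even_iff.1 h', mul_one, add_zero]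
      · rw [h'.neg_one_pow, Nat.odd_iff.1 h', toReal_eq_neg_of_ne h, mul_neg_one]
  obtain ⟨U, v, hv, h⟩ := key
  refine ⟨fun S => if S = U then v else 0, ?_, fun x hx hx' => ?_⟩
  · simp [polyWeight, apply_ite abs, hv]
  · rw [← h x hx hx', polyEval]
    simp

open Finset in
/-- Changing a multilinear polynomial by at most `2` on a set of `N` points changes the weight by
at most `2 * N`. -/
theorem wt_le_polyWeight_add {n : ℕ} (F : Cube n → ℤˣ) (c : Finset (Fin n) → ℝ)
    (hc : polyWeight c ≤ 1) (E : Finset (Cube n)) (hE : ∀ x ∉ E, polyEval c x = toReal (F x)) :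
    wt F ≤ polyWeight c + 2 * E.card := by
  -- The indicator of `y` has coefficients `monomial S y / 2 ^ n`, hence weight one; the errors on
  -- `E` are corrected point by point.
  have hcoeff := eq_coeff_of_polyEval_eq (fun x => toReal (F x))
    (fun S => c S + ∑ y ∈ E, (toReal (F y) - polyEval c y) * (1 / 2 ^ n * monomial S y)) (by
      intro x
      have h1 : polyEval (fun S => c S + ∑ y ∈ E, (toReal (F y) - polyEval c y)
          * (1 / 2 ^ n * monomial S y)) x = polyEval c x
          + ∑ y ∈ E, (toReal (F y) - polyEval c y) * (1 / 2 ^ n)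
            * ∑ S, monomial S y * monomial S x := by
        simp only [polyEval, add_mul, sum_add_distrib, sum_mul, mul_sum]
        rw [sum_comm]
        congr 1
        refine sum_congr rfl fun y _ => sum_congr rfl fun S _ => by ring
      rw [h1]
      simp only [sum_monomial_mul_point, mul_ite, mul_zero, sum_ite_eq']
      split_ifs with h
      · field_simp; ring
      · rw [add_zero]; exact hE x h)
  rw [wt, ← hcoeff]
  calc polyWeight (fun S => c S + ∑ y ∈ E, (toReal (F y) - polyEval c y)
        * (1 / 2 ^ n * monomial S y))
      ≤ ∑ S : Finset (Fin n), (|c S| + ∑ y ∈ E, 2 * (1 / 2 ^ n)) := by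
        refine sum_le_sum fun S _ => (abs_add_le _ _).trans ?_
        gcongr
        refine (abs_sum_le_sum_abs _ _).trans (sum_le_sum fun y _ => ?_)
        rw [abs_mul, abs_mul, abs_monomial, mul_one,
          abs_of_nonneg (by positivity : (0 : ℝ) ≤ 1 / 2 ^ n)]
        gcongr
        have := abs_sub (toReal (F y)) (polyEval c y)
        rw [abs_toReal] at this
        linarith [abs_polyEval_le c y]
    _ = polyWeight c + 2 * E.card := by
        rw [sum_add_distrib, polyWeight]
        congr 1
        simp only [sum_const, card_univ, Fintype.card_finset, Fintype.card_fin, nsmul_eq_mul]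
        push_cast
        field_simp

open Finset in
theorem log_wt_le {n : ℕ} {F : Cube n → ℤˣ} (hF : IsSymm F) :
    Real.log (wt F) ≤ 16 * ((r F : ℝ) * Real.log ((n : ℝ) / (r F : ℝ))) := by
  obtain ⟨c, hc, hcF⟩ := exists_monomial_eq_middle hF
  have h0 : r₀ F ≤ r F := le_max_left _ _
  have h1 : r₁ F ≤ r F := le_max_right _ _
  by_cases hr : r F = 0
  · have := wt_le_polyWeight_add F c hc.le ∅ fun x _ => hcF x (by omega) (by
      have := hammingWeight_le x; omega)
    rw [hc, card_empty, Nat.cast_zero, mul_zero, add_zero] at this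
    rw [hr, Nat.cast_zero, zero_mul, mul_zero]
    exact Real.log_nonpos (polyWeight_nonneg _) this
  · obtain ⟨k, hk, hrk, hrk', -⟩ := exists_jump F hr
    have hwt := wt_le_polyWeight_add F c hc.le
      (univ.filter fun x : Cube n => hammingWeight x ≤ r F ∨ n - hammingWeight x ≤ r F)
      fun x hx => by
        simp only [mem_filter, mem_univ, true_and, not_or, not_le] at hx
        exact hcF x (by omega) (by omega)
    have hcard := card_extreme_layers_le (n := n) (Nat.pos_of_ne_zero hr) (by omega)
    have hrpos : (1 : ℝ) ≤ r F := by exact_mod_cast Nat.one_le_iff_ne_zero.2 hr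
    -- The jump forces `n ≥ 2`, which excludes `n = r = 1`; the extreme case is then `n = 3`, `r =
    -- 2`.
    have hratio : (3 / 2 : ℝ) ≤ n / r F := by
      rw [le_div_iff₀ (by linarith)]
      have hadm := isAdmissible_r₀_r₁ F
      have : r F ≤ (n + 1) / 2 := max_le hadm.1 (by have := hadm.2.1; omega)
      have : 3 * r F ≤ 2 * n := by omega
      have : (3 : ℝ) * r F ≤ 2 * n := by exact_mod_cast this
      linarith
    have hlog : 1 / 3 ≤ Real.log (n / r F) := by
      have h1 := Real.one_sub_inv_le_log_of_pos (by norm_num : (0 : ℝ) < 3 / 2)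
      have h2 := Real.log_le_log (by norm_num) hratio
      norm_num at h1 ⊢
      linarith
    set q : ℝ := n / r F
    have hq : 0 < q := by linarith
    have hE : 1 ≤ Real.exp (r F) * q ^ r F :=
      one_le_mul_of_one_le_of_one_le (Real.one_le_exp (by linarith))
        (one_le_pow₀ (by linarith))
    have hle : wt F ≤ 5 * (Real.exp (r F) * q ^ r F) := by linarith
    have hpos : 0 < wt F := (approxWt_pos F).trans_le (approxWt_le_wt (by norm_num))
    have h2 := Real.log_le_log hpos hle
    rw [Real.log_mul (by norm_num) (by positivity), Real.log_mul (by positivity) (by positivity),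
      Real.log_exp, Real.log_pow] at h2
    have h5 := Real.log_le_sub_one_of_pos (by norm_num : (0 : ℝ) < 5)
    -- Since `1 / 3 ≤ log q`, the terms `log 5 ≤ 4` and `r` cost at most `12 * r * log q` and `3 * r
    -- * log q`, whence the constant 16.
    nlinarith

theorem le_log_approxWt {n : ℕ} {F : Cube n → ℤˣ} (hF : IsSymm F) (hr : r F ≠ 0) :
    1 / 1000 * (r F : ℝ) ≤ Real.log (approxWt (1 / 3) F) := by
  obtain ⟨k, hk, hrk, hrk', hD⟩ := exists_jump F hr
  -- For `r < 200` the bound `log (4 / 3) ≥ 1 / 4` suffices. Otherwise `T = r / 200` leaves room for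
  -- the blocks, as `4 * offset T + 1 ≤ 100 * T`, and rounding loses at most a factor two.
  by_cases hbig : r F < 200
  · have h1 : 4 / 3 ≤ approxWt (1 / 3) F :=
      le_approxWt (by norm_num) fun c hc => four_thirds_le_polyWeight hF hc hk hD
    have h2 := Real.one_sub_inv_le_log_of_pos (by norm_num : (0 : ℝ) < 4 / 3)
    have h3 := Real.log_le_log (by norm_num) h1
    have h4 : (r F : ℝ) < 200 := by exact_mod_cast hbig
    norm_num at h2 h3 ⊢
    linarith
  · obtain ⟨T, hT⟩ : ∃ T, T = r F / 200 := ⟨_, rfl⟩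
    have hT1 : 1 ≤ T := by omega
    have hoff : offset T = 12 + 25 * (T - 1) := by
      obtain ⟨S, rfl⟩ := Nat.exists_eq_add_of_le' hT1
      rfl
    have h1 : (2 : ℝ) ^ T ≤ approxWt (1 / 3) F :=
      le_approxWt (by norm_num) fun c hc =>
        two_pow_le_polyWeight hF hc hT1 (by omega) (by omega) hD
    have h3 := Real.log_le_log (by positivity) h1
    rw [Real.log_pow] at h3
    have h4 : (r F : ℝ) ≤ 400 * T := by exact_mod_cast (by omega : r F ≤ 400 * T)
    have h5 := Real.log_two_gt_d9
    nlinarith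

end Cube

theorem mainTheorem4 :
    ∃ c₀ c₁ : ℝ, 0 < c₀ ∧ 0 < c₁ ∧
      ∀ (n : ℕ) (F : Cube n → ℤˣ), Cube.IsSymm F →
        c₀ * ((Cube.r F : ℝ) * Real.log ((n : ℝ) / (Cube.r F : ℝ))) ≥ Real.log (Cube.wt F) ∧
        Real.log (Cube.wt F) ≥ Real.log (Cube.approxWt (1 / 3) F) ∧
        (Cube.r F ≠ 0 → Real.log (Cube.approxWt (1 / 3) F) ≥ c₁ * (Cube.r F : ℝ)) :=
  ⟨16, 1 / 1000, by norm_num, by norm_num, fun _ F hF => ⟨Cube.log_wt_le hF,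
    Real.log_le_log (Cube.approxWt_pos F) (Cube.approxWt_le_wt (by norm_num)),
    Cube.le_log_approxWt hF⟩⟩
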